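/- All graphs are finite, simple and undirected. For positive integers $\ell_1,\dots,\ell_k$, at most one of which equals $1$, let $P(\ell_1,\dots,\ell_k)$ be the graph obtained from paths with $\ell_1,\dots,\ell_k$ edges by identifying all their start nodes and identifying all their end nodes. Write $P(\alpha,\beta,\gamma\times 2)=P(\alpha,\beta,2,\dots,2)$ with $\gamma$ twos, and in particular $P(\ell_1,\ell_2,0\times 2)=P(\ell_1,\ell_2)$ and $P(\ell_1,0,0\times 2)=P(\ell_1)$. Let $\mathcal P'$ be the set of triples $$\mathcal P'=\{(\alpha,\beta,\gamma):\alpha\ge\beta\ge 2,\ \gamma\ge 1\}\cup\{(k-2,2,0):k\ge 4\}\cup\{(1,0,0)\}\cup\{(2,1,0)\}$$ of non-negative integers. For $(\alpha,\beta,\gamma)\in\mathcal P'$ define $\mathcal F(\alpha,\beta,\gamma)$ by the following eight (mutually exclusive and exhaustive) cases: $$\mathcal F(\alpha,\beta,\gamma)=\begin{cases} 2\beta\gamma+\frac{\alpha\beta}2-\frac{\beta^2}2+\frac\beta2-\frac\alpha2-2\gamma+2, & \alpha+\beta\text{ even},\ \alpha>\beta,\ \beta<\gamma+2;\\ 2\beta\gamma+\frac{\alpha\beta}2-\frac{\beta^2}2+\frac{3\beta}2-\frac\alpha2-3\gamma,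 & \alpha+\beta\text{ even},\ 3\beta<\alpha+6\gamma+8,\ (\alpha=\beta\text{ or }\beta\ge\gamma+2);\\ 2\beta\gamma+\frac{\alpha\beta}2-\frac{\beta^2}2+3\beta-\alpha-6\gamma-4, & \alpha+\beta\text{ even},\ 2\beta\le\alpha+4\gamma+6,\ 3\beta\ge\alpha+6\gamma+8;\\ 2\beta\gamma+\frac{\alpha\beta}2-\frac{\beta^2}2+\beta-\frac\alpha2-2\gamma+\frac32, & \alpha+\beta\text{ odd},\ \beta<2\gamma+3;\\ 2\beta\gamma+\frac{\alpha\beta}2-\frac{\beta^2}2+2\beta-\frac\alpha2-4\gamma-\frac32, & \alpha+\beta\text{ odd},\ 2\beta\le\alpha+4\gamma+6,\ \beta\ge2\gamma+3;\\ 2\gamma^2+\alpha\gamma+\frac{\alpha^2}8+\frac\alpha2, & \alpha\equiv0\pmod 4,\ 2\beta>\alpha+4\gamma+6;\\ 2\gamma^2+\alpha\gamma+\frac{\alpha^2}8+\frac\alpha2+\frac38, & \alpha\text{ odd},\ 2\beta>\alpha+4\gamma+6;\\ 2\gamma^2+\alpha\gamma+\frac{\alpha^2}8+\frac\alpha2+\frac12,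 & \alpha\equiv2\pmod 4,\ 2\beta>\alpha+4\gamma+6. \end{cases}$$ Let $H$ be a connected graph with at least two nodes. Two sets $A,B\subseteq V(H)$ touch if $A\cap B\neq\emptyset$ or some edge of $H$ has one endpoint in $A$ and the other in $B$. A clique embedding $\psi\colon K_k\to H$ assigns to each node $u$ of the complete graph $K_k$ a non-empty set $\psi(u)\subseteq V(H)$ inducing a connected subgraph of $H$, such that any two of these sets touch. Its weak edge depth is $$\mathrm{wed}(\psi)=\max_{\{a,b\}\in E(H)}\bigl|\{u\in V(K_k):\{a,b\}\cap\psi(u)\ne\emptyset\}\bigr|,$$ and the clique embedding power of $H$ is $$\mathrm{clemb}(H)=\sup_{k\ge3}\ \max_{\psi\colon K_k\to H}\ \frac{k}{\mathrm{wed}(\psi)},$$ where the maximum is over all clique embeddings of $K_k$ into $H$. Then for every $(\alpha,\beta,\gamma)\in\mathcal P'$, $$\mathrm{clemb}\bigl(P(\alpha,\beta,\gamma\times2)\bigr)\ \ge\ 2-\frac1{\mathcal F(\alpha,\beta,\gamma)}.$$ -/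

import Mathlib

/-- The nodes of the parallel-path graph with path lengths `ℓ i`: the common start node `inl false`,
the common end node `inl true`, and the `ℓ i - 1` inner nodes of the `i`-th path. -/
abbrev PNode {ι : Type*} (ℓ : ι → ℕ) : Type _ :=
  Bool ⊕ (Σ i : ι, Fin (ℓ i - 1))

/-- The `j`-th node (`0 ≤ j ≤ ℓ i`) on the `i`-th path: the start node for `j = 0`, the end node for
`j = ℓ i`, and an inner node of the path otherwise. -/
def pathNode {ι : Type*} (ℓ : ι → ℕ) (i : ι) (j : ℕ) : PNode ℓ :=
  if h0 : j = 0 then Sum.inl false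
  else if h : j < ℓ i then Sum.inr ⟨i, ⟨j - 1, by omega⟩⟩
  else Sum.inl true

/-- The `P`-graph `P(ℓ₁, …, ℓₖ)`: paths of lengths `ℓ i`, with all their start nodes identified and
all their end nodes identified. The edges are those between consecutive nodes of a path.
An entry `ℓ i = 0` contributes neither nodes nor edges, so such entries may be dropped. -/
def pGraph {ι : Type*} (ℓ : ι → ℕ) : SimpleGraph (PNode ℓ) :=
  SimpleGraph.fromEdgeSet
    {e | ∃ (i : ι) (j : ℕ), j < ℓ i ∧ e = s(pathNode ℓ i j, pathNode ℓ i (j + 1))}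

/-- The sequence of path lengths `α, β, 2, …, 2` with `γ` twos. -/
def tripleLengths (α β γ : ℕ) : Fin 2 ⊕ Fin γ → ℕ :=
  Sum.elim ![α, β] (fun _ => 2)

/-- The graph `P(α, β, γ × 2)`. As entries equal to `0` are dropped, `P(ℓ, 0, 0 × 2)` is `P(ℓ)`,
the path with `ℓ` edges. -/
def pGraphTriple (α β γ : ℕ) : SimpleGraph (PNode (tripleLengths α β γ)) :=
  pGraph (tripleLengths α β γ)

/-- The set `𝒫'` of triples describing the simple patterns. -/
def simpleTriples : Set (ℕ × ℕ × ℕ) :=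
  {p | ∃ α β γ : ℕ, α ≥ β ∧ β ≥ 2 ∧ γ ≥ 1 ∧ p = (α, β, γ)}
    ∪ {p | ∃ k : ℕ, k ≥ 4 ∧ p = (k - 2, 2, 0)}
    ∪ {(1, 0, 0)}
    ∪ {(2, 1, 0)}

/-- The savings function `𝓕` on `simpleTriples`. For `α ≥ β` the eight cases are mutually exclusive
and exhaustive, so the order of the cases is irrelevant and the final `else` is never reached. -/
noncomputable def savings (α β γ : ℕ) : ℝ :=
  let a : ℝ := α
  let b : ℝ := β
  let c : ℝ := γ
  if Even (α + β) ∧ α > β ∧ β < γ + 2 then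
    2 * b * c + a * b / 2 - b ^ 2 / 2 + b / 2 - a / 2 - 2 * c + 2
  else if Even (α + β) ∧ 3 * β < α + 6 * γ + 8 ∧ (α = β ∨ β ≥ γ + 2) then
    2 * b * c + a * b / 2 - b ^ 2 / 2 + 3 * b / 2 - a / 2 - 3 * c
  else if Even (α + β) ∧ 2 * β ≤ α + 4 * γ + 6 ∧ 3 * β ≥ α + 6 * γ + 8 then
    2 * b * c + a * b / 2 - b ^ 2 / 2 + 3 * b - a - 6 * c - 4
  else if Odd (α + β) ∧ β < 2 * γ + 3 then
    2 * b * c + a * b / 2 - b ^ 2 / 2 + b - a / 2 - 2 * c + 3 / 2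
  else if Odd (α + β) ∧ 2 * β ≤ α + 4 * γ + 6 ∧ β ≥ 2 * γ + 3 then
    2 * b * c + a * b / 2 - b ^ 2 / 2 + 2 * b - a / 2 - 4 * c - 3 / 2
  else if α % 4 = 0 ∧ 2 * β > α + 4 * γ + 6 then
    2 * c ^ 2 + a * c + a ^ 2 / 8 + a / 2
  else if Odd α ∧ 2 * β > α + 4 * γ + 6 then
    2 * c ^ 2 + a * c + a ^ 2 / 8 + a / 2 + 3 / 8
  else if α % 4 = 2 ∧ 2 * β > α + 4 * γ + 6 then
    2 * c ^ 2 + a * c + a ^ 2 / 8 + a / 2 + 1 / 2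
  else 0

/-- Two node sets touch if they intersect or are joined by an edge. -/
def Touch {V : Type*} (H : SimpleGraph V) (A B : Set V) : Prop :=
  (A ∩ B).Nonempty ∨ ∃ a ∈ A, ∃ b ∈ B, H.Adj a b

/-- `ψ` is an embedding of the clique `K_k`, with node set `Fin k`, into `H`: all `ψ u` are
non-empty and induce connected subgraphs, and any two of them touch. -/
def IsCliqueEmbedding {V : Type*} (H : SimpleGraph V) {k : ℕ} (ψ : Fin k → Set V) : Prop :=
  (∀ u, (ψ u).Nonempty ∧ (H.induce (ψ u)).Connected) ∧ ∀ u v, Touch H (ψ u) (ψ v)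

/-- The weak depth of `e`: the number of nodes of the clique whose image contains an endpoint
of `e`. -/
noncomputable def weakDepth {V : Type*} {k : ℕ} (ψ : Fin k → Set V) (e : Sym2 V) : ℕ :=
  {u : Fin k | ∃ a ∈ e, a ∈ ψ u}.ncard

/-- The weak edge depth: the maximum weak depth of an edge of `H`. (Weak depths are at most `k`,
so this supremum in `ℕ` is a maximum.) -/
noncomputable def weakEdgeDepth {V : Type*} (H : SimpleGraph V) {k : ℕ} (ψ : Fin k → Set V) : ℕ :=
  ⨆ e : H.edgeSet, weakDepth ψ (e : Sym2 V)

/-- The ratios `k / wed(ψ)` for `k ≥ 3` and clique embeddings `ψ` of `K_k` into `H`. -/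
def cliqueEmbeddingRatios {V : Type*} (H : SimpleGraph V) : Set ℝ :=
  {q | ∃ (k : ℕ) (ψ : Fin k → Set V), 3 ≤ k ∧ IsCliqueEmbedding H ψ ∧
    q = (k : ℝ) / (weakEdgeDepth H ψ : ℝ)}

/-- The clique embedding power of a finite connected graph `H` with at least two nodes.
By `bddAbove_cliqueEmbeddingRatios` this is a genuine supremum. -/
noncomputable def clemb {V : Type*} (H : SimpleGraph V) : ℝ :=
  sSup (cliqueEmbeddingRatios H)

theorem weakDepth_le_weakEdgeDepth {V : Type*} (H : SimpleGraph V) {k : ℕ} (ψ : Fin k → Set V)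
    {e : Sym2 V} (he : e ∈ H.edgeSet) : weakDepth ψ e ≤ weakEdgeDepth H ψ := by
  refine le_ciSup (f := fun e : H.edgeSet => weakDepth ψ (e : Sym2 V)) ⟨k, ?_⟩ ⟨e, he⟩
  rintro _ ⟨e, rfl⟩
  simpa [weakDepth] using Set.ncard_le_ncard (Set.subset_univ {u : Fin k | ∃ a ∈ e.1, a ∈ ψ u})

/-- In a finite connected graph with at least two nodes the ratios `k / wed(ψ)` are bounded. -/
theorem bddAbove_cliqueEmbeddingRatios {V : Type*} [Finite V] [Nontrivial V] (H : SimpleGraph V)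
    (hH : H.Connected) : BddAbove (cliqueEmbeddingRatios H) := by
  classical
  have := Fintype.ofFinite V
  refine ⟨(Fintype.card V : ℝ), ?_⟩
  rintro q ⟨k, ψ, -, hψ, rfl⟩
  have key : k ≤ Fintype.card V * weakEdgeDepth H ψ := by
    have h1 : (Finset.univ : Finset (Fin k)) ⊆
        Finset.univ.biUnion (fun v : V => Finset.univ.filter (fun u : Fin k => v ∈ ψ u)) := by
      intro u _
      obtain ⟨v, hv⟩ := (hψ.1 u).1
      exact Finset.mem_biUnion.2 ⟨v, Finset.mem_univ _, by simpa using hv⟩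
    have h2 : ∀ v ∈ (Finset.univ : Finset V),
        (Finset.univ.filter (fun u : Fin k => v ∈ ψ u)).card ≤ weakEdgeDepth H ψ := by
      intro v _
      obtain ⟨w, hw⟩ := hH.preconnected.exists_adj_of_nontrivial v
      refine le_trans ?_ (weakDepth_le_weakEdgeDepth H ψ (e := s(v, w)) hw)
      rw [weakDepth, ← Set.ncard_coe_finset]
      refine Set.ncard_le_ncard ?_ (Set.toFinite _)
      intro u hu
      exact ⟨v, by simp, by simpa using hu⟩
    calc k = (Finset.univ : Finset (Fin k)).card := by simp
      _ ≤ _ := Finset.card_le_card h1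
      _ ≤ _ := Finset.card_biUnion_le_card_mul _ _ _ h2
      _ = _ := by simp
  refine div_le_of_le_mul₀ (by positivity) (by positivity) ?_
  exact_mod_cast key

/-!
The bound is witnessed by a bramble (a family of connected, pairwise touching sets) in
`P(α, β, γ × 2)` with `2 * F - 1` members such that every edge meets at most `F = 𝓕(α, β, γ)` of
them. Write `s` and `t` for the end nodes. For a parameter `n ≥ 1` the members are the following.

* `n` arcs inside the path of length `α` and `n - 1` sets containing both `s` and `t`. On the cycle
  formed by this path and a path of length two, these are two families of translates: going from `s`
  to the middle, one arc begins at each step and one set containing both end nodes ends, so that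
  together they load each outer edge exactly `n` times.
* For each of the `γ` paths of length two, a set reaching from `s` to its inner node and a set
  reaching from `t` to it. They touch every set containing `t` or `s`, respectively.
* A set that contains `s` and all inner nodes of the path of length `β`, and the same for `t`.
* `U` sets at `s` and `U` sets at `t`, arranged in a staircase: a set of level `i` at `s` reaches
  `i` steps further on the path of length `α` and `i` steps less far on the path of length `β` than
  a set of level `0`, and conversely at `t`. A set of level `i` at `s` and a set of level `j` at `t`
  touch on the first path if `j ≤ i` and on the second one if `i < j`.

Then `F = n + γ + 1 + U`, and each inner edge of either long path becomes one inequality between the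
numbers of sets at `s` and at `t` up to a given level (`Staircase.count_first`,
`Staircase.count_second`). `Staircase.two_sub_le_clemb` derives the bound from these two families
of inequalities.

The inequalities are solved greedily (`Staircase.ofPeriod`), with levels growing by one
every `n + 2 * γ` sets. How large `U` can be depends on how many levels fit on the two paths. This
gives three values of `F` in terms of `n`, for `α ≥ 2 * n + β - 1`, for `α ≥ 2 * n + β - 2` and
for `α ≤ 2 * n + β - 3`, and the eight cases of `𝓕` arise from the best choice of `n`.
-/

/-! ### Lower bounds on the clique embedding power -/

theorem Touch.symm {V : Type*} {H : SimpleGraph V} {A B : Set V} (h : Touch H A B) :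
    Touch H B A := by
  rcases h with h | ⟨a, ha, b, hb, hab⟩
  · exact Or.inl (by rwa [Set.inter_comm])
  · exact Or.inr ⟨b, hb, a, ha, hab.symm⟩

theorem touch_of_mem {V : Type*} {H : SimpleGraph V} {A B : Set V} {v : V} (hA : v ∈ A)
    (hB : v ∈ B) : Touch H A B :=
  Or.inl ⟨v, hA, hB⟩

/-- A bramble indexed by any finite type, in which every edge meets at most `F` members, bounds the
clique embedding power from below. -/
theorem card_div_le_clemb {V I : Type*} [Finite V] [Nontrivial V] [Fintype I]
    {H : SimpleGraph V} (hH : H.Connected) (φ : I → Set V) (hcard : 3 ≤ Fintype.card I)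
    (hconn : ∀ u, (φ u).Nonempty ∧ (H.induce (φ u)).Connected)
    (htouch : ∀ u v, Touch H (φ u) (φ v)) (F : ℕ)
    (hF : ∀ e ∈ H.edgeSet, {u | ∃ a ∈ e, a ∈ φ u}.ncard ≤ F) :
    (Fintype.card I : ℝ) / F ≤ clemb H := by
  set ε := (Fintype.equivFin I).symm
  set ψ : Fin (Fintype.card I) → Set V := fun u => φ (ε u)
  have hdepth : weakEdgeDepth H ψ ≤ F := by
    refine ciSup_le' fun e => ?_
    refine le_trans (le_of_eq ?_) (hF e e.2)
    exact Set.ncard_preimage_of_injective_subset_range ε.injective (by simp)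
      (s := {u | ∃ a ∈ (e : Sym2 V), a ∈ φ u})
  -- Without this the ratio for `ψ` would be the junk value `k / 0 = 0`.
  have hpos : 0 < weakEdgeDepth H ψ := by
    let u : Fin (Fintype.card I) := ⟨0, by omega⟩
    obtain ⟨a, ha⟩ := (hconn (ε u)).1
    obtain ⟨b, hb⟩ := hH.preconnected.exists_adj_of_nontrivial a
    refine lt_of_lt_of_le ?_ (weakDepth_le_weakEdgeDepth H ψ (e := s(a, b)) hb)
    exact (Set.ncard_pos (Set.toFinite _)).2 ⟨u, a, by simp, ha⟩
  calc (Fintype.card I : ℝ) / F ≤ (Fintype.card I : ℝ) / (weakEdgeDepth H ψ : ℝ) := by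
        gcongr
    _ ≤ clemb H := le_csSup (bddAbove_cliqueEmbeddingRatios H hH)
        ⟨_, ψ, hcard, ⟨fun u => hconn _, fun u v => htouch _ _⟩, rfl⟩

/-! ### Connected sets in parallel-path graphs -/

section ParallelPaths

variable {ι : Type*} {ℓ : ι → ℕ}

theorem pGraph_adj (i : ι) {j : ℕ} (hj : j < ℓ i) :
    (pGraph ℓ).Adj (pathNode ℓ i j) (pathNode ℓ i (j + 1)) := by
  rw [pGraph, SimpleGraph.fromEdgeSet_adj]
  refine ⟨⟨i, j, hj, rfl⟩, ?_⟩
  unfold pathNode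
  split_ifs <;> simp <;> omega

theorem exists_of_mem_edgeSet_pGraph {e : Sym2 (PNode ℓ)} (he : e ∈ (pGraph ℓ).edgeSet) :
    ∃ i j, j < ℓ i ∧ e = s(pathNode ℓ i j, pathNode ℓ i (j + 1)) := by
  rw [pGraph, SimpleGraph.edgeSet_fromEdgeSet] at he
  exact he.1

theorem touch_of_pathNode {A B : Set (PNode ℓ)} (i : ι) {j : ℕ} (hj : j < ℓ i)
    (hA : pathNode ℓ i j ∈ A) (hB : pathNode ℓ i (j + 1) ∈ B) : Touch (pGraph ℓ) A B :=
  Or.inr ⟨_, hA, _, hB, pGraph_adj i hj⟩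

theorem pathNode_zero (i : ι) : pathNode ℓ i 0 = Sum.inl false := by
  simp [pathNode]

theorem pathNode_length {i : ι} (hi : 1 ≤ ℓ i) : pathNode ℓ i (ℓ i) = Sum.inl true := by
  simp [pathNode, show ℓ i ≠ 0 by omega]

theorem inr_eq_pathNode (a : Σ i : ι, Fin (ℓ i - 1)) :
    (Sum.inr a : PNode ℓ) = pathNode ℓ a.1 (a.2 + 1) := by
  obtain ⟨i, k, hk⟩ := a
  simp [pathNode, show k + 1 < ℓ i by omega]

theorem reachable_pathNode {S : Set (PNode ℓ)} (i : ι) {j k : ℕ} (hjk : j ≤ k) (hk : k ≤ ℓ i)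
    (hS : ∀ m, j ≤ m → m ≤ k → pathNode ℓ i m ∈ S) :
    ((pGraph ℓ).induce S).Reachable ⟨pathNode ℓ i j, hS j le_rfl hjk⟩
      ⟨pathNode ℓ i k, hS k hjk le_rfl⟩ := by
  induction k, hjk using Nat.le_induction with
  | base => exact SimpleGraph.Reachable.refl _
  | succ k hjk ih =>
    refine (ih (by omega) fun m h1 h2 => hS m h1 (by omega)).trans ?_
    refine SimpleGraph.Adj.reachable ?_
    exact pGraph_adj i (by omega)

theorem connected_pGraph (i₀ : ι) (h : 1 ≤ ℓ i₀) :
    ((pGraph ℓ).induce (Set.univ : Set (PNode ℓ))).Connected := by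
  rw [SimpleGraph.connected_iff_exists_forall_reachable]
  refine ⟨⟨Sum.inl false, trivial⟩, ?_⟩
  have key : ∀ i j, j ≤ ℓ i → ((pGraph ℓ).induce (Set.univ : Set (PNode ℓ))).Reachable
      ⟨Sum.inl false, trivial⟩ ⟨pathNode ℓ i j, trivial⟩ := by
    intro i j hj
    have := reachable_pathNode (ℓ := ℓ) (S := Set.univ) i (Nat.zero_le j) hj
      (fun _ _ _ => Set.mem_univ _)
    simpa only [pathNode_zero] using this
  rintro ⟨(b | a), -⟩
  · cases b
    · exact SimpleGraph.Reachable.refl _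
    · simpa only [pathNode_length h] using key i₀ (ℓ i₀) le_rfl
  · have := a.2.2
    simpa only [inr_eq_pathNode] using key a.1 (a.2 + 1) (by omega)

/-- The union of the initial segments `0, …, x i` of the paths, for `x i < ℓ i`. -/
def startSet (ℓ : ι → ℕ) (x : ι → ℕ) : Set (PNode ℓ) :=
  {v | Sum.elim (fun b => b = false) (fun a => a.2 + 1 ≤ x a.1) v}

/-- The union of the final segments `ℓ i - y i, …, ℓ i` of the paths, for `y i < ℓ i`. -/
def endSet (ℓ : ι → ℕ) (y : ι → ℕ) : Set (PNode ℓ) :=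
  {v | Sum.elim (fun b => b = true) (fun a => ℓ a.1 ≤ a.2 + 1 + y a.1) v}

/-- The segment `a, …, b` of the path `i`. -/
def innerSet (ℓ : ι → ℕ) (i : ι) (a b : ℕ) : Set (PNode ℓ) :=
  {v | ∃ j, a ≤ j ∧ j ≤ b ∧ v = pathNode ℓ i j}

theorem mem_startSet {x : ι → ℕ} {i : ι} (hi : x i < ℓ i) {j : ℕ} (hj : j ≤ ℓ i) :
    pathNode ℓ i j ∈ startSet ℓ x ↔ j ≤ x i := by
  unfold pathNode startSet
  split_ifs
  · simp_all
  · simp only [Set.mem_ofPred_eq, Sum.elim_inr]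
    omega
  · simp only [Set.mem_ofPred_eq, Sum.elim_inl, Bool.true_eq_false, false_iff]
    omega

theorem mem_endSet {y : ι → ℕ} {i : ι} (hi : y i < ℓ i) {j : ℕ} (hj : j ≤ ℓ i) :
    pathNode ℓ i j ∈ endSet ℓ y ↔ ℓ i ≤ j + y i := by
  unfold pathNode endSet
  split_ifs
  · simp only [Set.mem_ofPred_eq, Sum.elim_inl, Bool.false_eq_true, false_iff]
    omega
  · simp only [Set.mem_ofPred_eq, Sum.elim_inr]
    omega
  · simp only [Set.mem_ofPred_eq, Sum.elim_inl, true_iff]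
    omega

theorem mem_innerSet {i i' : ι} {a b j : ℕ} (ha : 1 ≤ a) (hb : b < ℓ i') :
    pathNode ℓ i j ∈ innerSet ℓ i' a b ↔ i = i' ∧ a ≤ j ∧ j ≤ b := by
  constructor
  · rintro ⟨k, h1, h2, h⟩
    unfold pathNode at h
    split_ifs at h <;> first | omega | exact absurd h Sum.inr_ne_inl | skip
    have h3 := Sum.inr.inj h
    obtain rfl : i = i' := congrArg Sigma.fst h3
    have h4 : j - 1 = k - 1 := congrArg (fun a : Σ i : ι, Fin (ℓ i - 1) => (a.2 : ℕ)) h3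
    exact ⟨rfl, by omega, by omega⟩
  · rintro ⟨rfl, h1, h2⟩
    exact ⟨j, h1, h2, rfl⟩

theorem connected_startSet {x : ι → ℕ} (hx : ∀ i, x i < ℓ i) :
    ((pGraph ℓ).induce (startSet ℓ x)).Connected := by
  rw [SimpleGraph.connected_iff_exists_forall_reachable]
  refine ⟨⟨Sum.inl false, rfl⟩, ?_⟩
  rintro ⟨(b | ⟨i, k, hk⟩), hv⟩
  · cases b
    · exact SimpleGraph.Reachable.refl _
    · exact absurd hv (by simp [startSet])
  · have hv' : k + 1 ≤ x i := hv
    have := reachable_pathNode (ℓ := ℓ) (S := startSet ℓ x) i (Nat.zero_le (k + 1)) (by omega)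
      (fun m _ hm => (mem_startSet (hx i) (by omega)).2 (by omega))
    simpa only [pathNode_zero, inr_eq_pathNode] using this

theorem connected_endSet {y : ι → ℕ} (hy : ∀ i, y i < ℓ i) :
    ((pGraph ℓ).induce (endSet ℓ y)).Connected := by
  rw [SimpleGraph.connected_iff_exists_forall_reachable]
  refine ⟨⟨Sum.inl true, rfl⟩, ?_⟩
  rintro ⟨(b | ⟨i, k, hk⟩), hv⟩
  · cases b
    · exact absurd hv (by simp [endSet])
    · exact SimpleGraph.Reachable.refl _
  · have hv' : ℓ i ≤ k + 1 + y i := hv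
    have := reachable_pathNode (ℓ := ℓ) (S := endSet ℓ y) i (show k + 1 ≤ ℓ i by omega) le_rfl
      (fun m _ hm => (mem_endSet (hy i) (by omega)).2 (by omega))
    have hi : 1 ≤ ℓ i := by omega
    simpa only [pathNode_length hi, inr_eq_pathNode] using this.symm

theorem connected_innerSet {i : ι} {a b : ℕ} (hab : a ≤ b) (hb : b ≤ ℓ i) :
    ((pGraph ℓ).induce (innerSet ℓ i a b)).Connected := by
  rw [SimpleGraph.connected_iff_exists_forall_reachable]
  refine ⟨⟨pathNode ℓ i a, a, le_rfl, hab, rfl⟩, ?_⟩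
  rintro ⟨_, j, h1, h2, rfl⟩
  exact reachable_pathNode (S := innerSet ℓ i a b) i h1 (by omega)
    fun m h3 h4 => ⟨m, h3, by omega, rfl⟩

end ParallelPaths

/-! ### Counting -/

theorem ncard_sum {A B : Type*} [Finite A] [Finite B] (P : A ⊕ B → Prop) :
    {u | P u}.ncard = {a | P (Sum.inl a)}.ncard + {b | P (Sum.inr b)}.ncard := by
  rw [← Nat.card_coe_set_eq, ← Nat.card_coe_set_eq, ← Nat.card_coe_set_eq, ← Nat.card_sum]
  exact Nat.card_congr Equiv.subtypeSum

theorem ncard_le_of_imp {A : Type*} [Finite A] {P Q : A → Prop} (h : ∀ a, P a → Q a) :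
    {a | P a}.ncard ≤ {a | Q a}.ncard :=
  Set.ncard_le_ncard h (Set.toFinite _)

theorem ncard_eq_zero_of_forall_not {A : Type*} {P : A → Prop} (h : ∀ a, ¬ P a) :
    {a | P a}.ncard = 0 := by
  simp [h]

theorem ncard_le_card {A : Type*} [Fintype A] (P : A → Prop) :
    {a | P a}.ncard ≤ Fintype.card A := by
  rw [← Nat.card_eq_fintype_card, ← Set.ncard_univ]
  exact Set.ncard_le_ncard (Set.subset_univ _) (Set.toFinite _)

theorem ncard_add_ncard_not {A : Type*} [Fintype A] (P : A → Prop) :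
    {a | P a}.ncard + {a | ¬ P a}.ncard = Fintype.card A := by
  rw [← Nat.card_eq_fintype_card]
  exact Set.ncard_add_ncard_compl {a | P a} (Set.toFinite _) (Set.toFinite _)

theorem ncard_fin_lt (n m : ℕ) : {k : Fin n | (k : ℕ) < m}.ncard = min n m := by
  rw [← Fin.card_filter_val_lt, ← Set.ncard_coe_finset]
  simp

theorem ncard_fin_ge (n m : ℕ) : {k : Fin n | m ≤ (k : ℕ)}.ncard = n - m := by
  have h := ncard_add_ncard_not fun k : Fin n => (k : ℕ) < m
  simp only [not_lt, Fintype.card_fin, ncard_fin_lt] at h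
  omega

/-! ### The bramble -/

/-- The parameters of the bramble in `P(α, β, γ × 2)`: the number `n` of arcs inside the first path,
the number `U` of staircase sets at either end, and the levels `i` and `j` of these sets. The `u`-th
staircase set at the start node reaches to node `p + i u` of the first path and to node `q - i u` of
the second one; the `v`-th staircase set at the end node begins at node `p + j v + 1` of the
first path and at node `q + 2 - j v` of the second one. Hence the two sets touch on the first path if
`j v ≤ i u` and on the second one otherwise. -/
structure Staircase (α β γ : ℕ) where
  /-- The number of arcs inside the first path. -/
  n : ℕ
  /-- The number of staircase sets at either end. -/
  U : ℕ
  /-- The offset of the levels on the first path. -/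
  p : ℕ
  /-- The offset of the levels on the second path. -/
  q : ℕ
  /-- The levels of the staircase sets at the start node. -/
  i : Fin U → ℕ
  /-- The levels of the staircase sets at the end node. -/
  j : Fin U → ℕ
  one_le_n : 1 ≤ n
  two_mul_n_le : 2 * n ≤ α
  one_le_beta : 1 ≤ β
  beta_eq_one : β = 1 → n = 1 ∧ γ = 0 ∧ U = 0
  gamma_eq_zero : γ = 0 → n = 1 ∨ β = 2
  p_le : p ≤ n
  i_bounds : ∀ u, n ≤ p + i u + 1 ∧ p + i u + n + 1 ≤ α ∧ q + 2 ≤ β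
  j_bounds : ∀ v, n ≤ p + j v ∧ p + j v + n ≤ α ∧ j v ≤ q ∧ q + 2 ≤ β
  /-- This bounds the weak depth of the inner edges of the first path. -/
  count_first : ∀ f, {v | j v ≤ f}.ncard ≤ {u | i u < f}.ncard + γ + 1
  /-- This bounds the weak depth of the inner edges of the second path. -/
  count_second : ∀ g, {u | i u ≤ g}.ncard + 1 ≤ {v | j v ≤ g}.ncard + n + γ

/-- Extents of a set on the paths of `P(α, β, γ × 2)`: `a` and `b` on the first two paths, `c` on
the paths of length two. -/
def extents {γ : ℕ} (a b : ℕ) (c : Fin γ → ℕ) : Fin 2 ⊕ Fin γ → ℕ :=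
  Sum.elim ![a, b] c

theorem extents_lt {α β γ a b : ℕ} {c : Fin γ → ℕ} (ha : a < α) (hb : b < β) (hc : ∀ m, c m < 2)
    (i : Fin 2 ⊕ Fin γ) : extents a b c i < tripleLengths α β γ i := by
  rcases i with i | m
  · fin_cases i
    · exact ha
    · exact hb
  · exact hc m

namespace Staircase

variable {α β γ : ℕ} (D : Staircase α β γ)

/-- The bound for the weak depths of the edges. -/
def depth : ℕ := D.n + γ + 1 + D.U

/-- Indices of the members of the bramble that contain exactly one of the two end nodes, sorted by
that node: one for each path of length two, one that covers the second path, and the staircase. -/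
abbrev Side : Type := Fin γ ⊕ (Unit ⊕ Fin D.U)

/-- Indices of the members of the bramble: the arcs inside the first path, the sets that contain
both end nodes, and the sets that contain only the start node or only the end node. -/
abbrev Index : Type := (Fin D.n ⊕ Fin (D.n - 1)) ⊕ (D.Side ⊕ D.Side)

/-- The extents of the members that contain only the start node. -/
def startExtents : D.Side → Fin 2 ⊕ Fin γ → ℕ
  | Sum.inl m => extents (D.n - 1) 0 (fun m' => if m' = m then 1 else 0)
  | Sum.inr (Sum.inl _) => extents (D.n - 1) (β - 1) (fun _ => 0)
  | Sum.inr (Sum.inr u) => extents (D.p + D.i u) (D.q - D.i u) (fun _ => 0)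

/-- The extents of the members that contain only the end node. -/
def endExtents : D.Side → Fin 2 ⊕ Fin γ → ℕ
  | Sum.inl m => extents (D.n - 1) 0 (fun m' => if m' = m then 1 else 0)
  | Sum.inr (Sum.inl _) => extents (D.n - 1) (β - 1) (fun _ => 0)
  | Sum.inr (Sum.inr v) => extents (α - 1 - D.p - D.j v) (β - 2 - D.q + D.j v) (fun _ => 0)

/-- The extents, towards either end, of a member that contains both end nodes. It is connected
through the paths of length two, to which the second path belongs if `β = 2`. -/
def bothExtents (β γ a : ℕ) : Fin 2 ⊕ Fin γ → ℕ :=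
  extents a (if β = 2 then 1 else 0) (fun _ => 1)

/-- The bramble. On the cycle formed by the first path and a path of length two, the
arcs inside the first path and the sets containing both end nodes are two families of translates: the
`k`-th arc touches the `l`-th such set at its left end if `k ≤ l` and at its right end otherwise. -/
def bramble : D.Index → Set (PNode (tripleLengths α β γ))
  | Sum.inl (Sum.inl k) => innerSet _ (Sum.inl 0) (k + 1) (α - D.n + k)
  | Sum.inl (Sum.inr l) =>
    startSet _ (bothExtents β γ l) ∪ endSet _ (bothExtents β γ (D.n - 2 - l))
  | Sum.inr (Sum.inl w) => startSet _ (D.startExtents w)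
  | Sum.inr (Sum.inr w) => endSet _ (D.endExtents w)

theorem startExtents_lt (w : D.Side) (i : Fin 2 ⊕ Fin γ) :
    D.startExtents w i < tripleLengths α β γ i := by
  have h1 := D.one_le_n
  have h2 := D.two_mul_n_le
  have h3 := D.one_le_beta
  rcases w with m | _ | u
  · exact extents_lt (by omega) (by omega) (fun m' => by split_ifs <;> omega) i
  · exact extents_lt (by omega) (by omega) (fun m' => by omega) i
  · have := D.i_bounds u
    exact extents_lt (by omega) (by omega) (fun m' => by omega) i

theorem endExtents_lt (w : D.Side) (i : Fin 2 ⊕ Fin γ) :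
    D.endExtents w i < tripleLengths α β γ i := by
  have h1 := D.one_le_n
  have h2 := D.two_mul_n_le
  have h3 := D.one_le_beta
  rcases w with m | _ | u
  · exact extents_lt (by omega) (by omega) (fun m' => by split_ifs <;> omega) i
  · exact extents_lt (by omega) (by omega) (fun m' => by omega) i
  · have := D.j_bounds u
    exact extents_lt (by omega) (by omega) (fun m' => by omega) i

theorem bothExtents_lt (D : Staircase α β γ) {a : ℕ} (ha : a < α) (i : Fin 2 ⊕ Fin γ) :
    bothExtents β γ a i < tripleLengths α β γ i := by
  have h3 := D.one_le_beta
  exact extents_lt ha (by split_ifs <;> omega) (fun _ => by omega) i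

theorem one_le_length (D : Staircase α β γ) (i : Fin 2 ⊕ Fin γ) : 1 ≤ tripleLengths α β γ i :=
  have h1 := D.one_le_n
  have h2 := D.two_mul_n_le
  Nat.one_le_of_lt (D.bothExtents_lt (a := 0) (by omega) i)

/-! ### Connectedness and touching -/

theorem card_index : Fintype.card D.Index = 2 * D.depth - 1 := by
  have h1 := D.one_le_n
  simp only [Fintype.card_sum, Fintype.card_fin, Fintype.card_unit, depth]
  omega

theorem start_mem (x : Fin 2 ⊕ Fin γ → ℕ) : Sum.inl false ∈ startSet (tripleLengths α β γ) x :=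
  rfl

theorem end_mem (x : Fin 2 ⊕ Fin γ → ℕ) : Sum.inl true ∈ endSet (tripleLengths α β γ) x :=
  rfl

/-- The node between the two halves of a set containing both end nodes: the inner node of a path of
length two. -/
theorem exists_mem_inter (D : Staircase α β γ) (hn : 2 ≤ D.n) {a b : ℕ} (ha : a < α) (hb : b < α) :
    (startSet (tripleLengths α β γ) (bothExtents β γ a) ∩ endSet _ (bothExtents β γ b)).Nonempty := by
  rcases Nat.eq_zero_or_pos γ with h | h
  · have hβ : β = 2 := (D.gamma_eq_zero h).resolve_left (by omega)
    refine ⟨pathNode _ (Sum.inl 1) 1, (mem_startSet (D.bothExtents_lt ha _) ?_).2 ?_,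
      (mem_endSet (D.bothExtents_lt hb _) ?_).2 ?_⟩ <;>
    simp [bothExtents, extents, tripleLengths, hβ]
  · refine ⟨pathNode _ (Sum.inr ⟨0, h⟩) 1, (mem_startSet (D.bothExtents_lt ha _) ?_).2 ?_,
      (mem_endSet (D.bothExtents_lt hb _) ?_).2 ?_⟩ <;>
    simp [bothExtents, extents, tripleLengths]

theorem connected_bramble (u : D.Index) : (D.bramble u).Nonempty ∧
    ((pGraphTriple α β γ).induce (D.bramble u)).Connected := by
  have h1 := D.one_le_n
  have h2 := D.two_mul_n_le
  suffices h : ((pGraphTriple α β γ).induce (D.bramble u)).Connected from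
    ⟨Set.nonempty_coe_sort.1 h.nonempty, h⟩
  rcases u with (k | l) | w | w
  · exact connected_innerSet (show (k : ℕ) + 1 ≤ α - D.n + k by omega)
      (show α - D.n + k ≤ α by omega)
  · have := l.isLt
    exact SimpleGraph.induce_union_connected
      (connected_startSet (D.bothExtents_lt (a := l) (by omega))).preconnected
      (connected_endSet (D.bothExtents_lt (a := D.n - 2 - l) (by omega))).preconnected
      (D.exists_mem_inter (a := l) (b := D.n - 2 - l) (by omega) (by omega) (by omega))
  · exact connected_startSet (D.startExtents_lt w)
  · exact connected_endSet (D.endExtents_lt w)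

/-- The members that contain exactly one end node reach sufficiently far to touch all arcs. -/
theorem n_le_startExtents (w : D.Side) : D.n ≤ D.startExtents w (Sum.inl 0) + 1 := by
  have h1 := D.one_le_n
  rcases w with m | _ | u
  · change D.n ≤ D.n - 1 + 1; omega
  · change D.n ≤ D.n - 1 + 1; omega
  · exact (D.i_bounds u).1

theorem n_le_endExtents (w : D.Side) : D.n ≤ D.endExtents w (Sum.inl 0) + 1 := by
  have h1 := D.one_le_n
  rcases w with m | _ | v
  · change D.n ≤ D.n - 1 + 1; omega
  · change D.n ≤ D.n - 1 + 1; omega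
  · have := D.j_bounds v
    change D.n ≤ α - 1 - D.p - D.j v + 1; omega

theorem touch_inner_start {x : Fin 2 ⊕ Fin γ → ℕ} (hx : ∀ i, x i < tripleLengths α β γ i)
    {a b : ℕ} (hb : b < α) (hab : a + 1 ≤ b) (ha : a ≤ x (Sum.inl 0)) :
    Touch (pGraphTriple α β γ) (innerSet _ (Sum.inl 0) (a + 1) b) (startSet _ x) :=
  (touch_of_pathNode (ℓ := tripleLengths α β γ) (B := innerSet _ (Sum.inl 0) (a + 1) b)
    (Sum.inl 0) (j := a) (show a < α by omega)
    ((mem_startSet (hx _) (show a ≤ α by omega)).2 ha) ⟨a + 1, le_rfl, hab, rfl⟩).symm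

theorem touch_inner_end {y : Fin 2 ⊕ Fin γ → ℕ} (hy : ∀ i, y i < tripleLengths α β γ i)
    {a b : ℕ} (hb : b < α) (hab : a ≤ b) (hα : α ≤ b + 1 + y (Sum.inl 0)) :
    Touch (pGraphTriple α β γ) (innerSet _ (Sum.inl 0) a b) (endSet _ y) :=
  touch_of_pathNode (ℓ := tripleLengths α β γ) (A := innerSet _ (Sum.inl 0) a b)
    (Sum.inl 0) (j := b) hb ⟨b, hab, le_rfl, rfl⟩ ((mem_endSet (hy _) (show b + 1 ≤ α by omega)).2 hα)

/-- A set containing the start node and a set containing the end node touch if their extents on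
some path together cover it. -/
theorem touch_start_end {x y : Fin 2 ⊕ Fin γ → ℕ} (hx : ∀ i, x i < tripleLengths α β γ i)
    (hy : ∀ i, y i < tripleLengths α β γ i) (i : Fin 2 ⊕ Fin γ)
    (h : tripleLengths α β γ i ≤ x i + 1 + y i) :
    Touch (pGraphTriple α β γ) (startSet _ x) (endSet _ y) := by
  have := hx i
  exact touch_of_pathNode i this ((mem_startSet this this.le).2 le_rfl)
    ((mem_endSet (hy i) this).2 h)

theorem touch_sides (w w' : D.Side) :
    Touch (pGraphTriple α β γ) (startSet _ (D.startExtents w)) (endSet _ (D.endExtents w')) := by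
  have h2 := D.one_le_beta
  refine (?_ : ∃ i, tripleLengths α β γ i ≤ D.startExtents w i + 1 + D.endExtents w' i).elim
    (touch_start_end (D.startExtents_lt w) (D.endExtents_lt w'))
  rcases w with m | _ | u
  · refine ⟨Sum.inr m, ?_⟩
    change 2 ≤ (if m = m then 1 else 0) + 1 + _
    rw [if_pos rfl]
    omega
  · refine ⟨Sum.inl 1, ?_⟩
    change β ≤ β - 1 + 1 + _
    omega
  · rcases w' with m | _ | v
    · refine ⟨Sum.inr m, ?_⟩
      change 2 ≤ 0 + 1 + (if m = m then 1 else 0)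
      rw [if_pos rfl]
    · refine ⟨Sum.inl 1, ?_⟩
      change β ≤ _ + 1 + (β - 1)
      omega
    · have h3 := D.i_bounds u
      have h4 := D.j_bounds v
      rcases le_or_gt (D.j v) (D.i u) with h | h
      · refine ⟨Sum.inl 0, ?_⟩
        change α ≤ D.p + D.i u + 1 + (α - 1 - D.p - D.j v)
        omega
      · refine ⟨Sum.inl 1, ?_⟩
        change β ≤ D.q - D.i u + 1 + (β - 2 - D.q + D.j v)
        omega

theorem touch_bramble (u v : D.Index) :
    Touch (pGraphTriple α β γ) (D.bramble u) (D.bramble v) := by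
  have h1 := D.one_le_n
  have h2 := D.two_mul_n_le
  -- An arc and a set containing both end nodes are adjacent to the left or to the right of the arc.
  have hNB : ∀ (k : Fin D.n) (l : Fin (D.n - 1)), Touch (pGraphTriple α β γ)
      (D.bramble (Sum.inl (Sum.inl k))) (D.bramble (Sum.inl (Sum.inr l))) := by
    intro k l
    rcases le_or_gt (k : ℕ) l with h | h
    · rcases touch_inner_start (D.bothExtents_lt (a := l) (by omega)) (a := k) (b := α - D.n + k)
        (by omega) (by omega) h with ⟨v, h3, h4⟩ | ⟨a, ha, b, hb, hab⟩
      · exact Or.inl ⟨v, h3, Or.inl h4⟩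
      · exact Or.inr ⟨a, ha, b, Or.inl hb, hab⟩
    · rcases touch_inner_end (D.bothExtents_lt (a := D.n - 2 - l) (by omega)) (a := k + 1)
        (b := α - D.n + k) (by omega) (by omega)
        (by change α ≤ α - D.n + k + 1 + (D.n - 2 - l); omega) with
        ⟨v, h3, h4⟩ | ⟨a, ha, b, hb, hab⟩
      · exact Or.inl ⟨v, h3, Or.inr h4⟩
      · exact Or.inr ⟨a, ha, b, Or.inr hb, hab⟩
  have hNS : ∀ (k : Fin D.n) (w : D.Side), Touch (pGraphTriple α β γ)
      (D.bramble (Sum.inl (Sum.inl k))) (D.bramble (Sum.inr (Sum.inl w))) := by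
    intro k w
    have := D.n_le_startExtents w
    exact touch_inner_start (D.startExtents_lt w) (by omega) (by omega) (by omega)
  have hNT : ∀ (k : Fin D.n) (w : D.Side), Touch (pGraphTriple α β γ)
      (D.bramble (Sum.inl (Sum.inl k))) (D.bramble (Sum.inr (Sum.inr w))) := by
    intro k w
    have := D.n_le_endExtents w
    exact touch_inner_end (D.endExtents_lt w) (by omega) (by omega) (by omega)
  rcases u with (k | l) | w | w <;> rcases v with (k' | l') | w' | w'
  -- All arcs contain the `n`-th node of the first path.
  · exact touch_of_mem (v := pathNode _ (Sum.inl 0) D.n) ⟨D.n, by omega, by omega, rfl⟩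
      ⟨D.n, by omega, by omega, rfl⟩
  · exact hNB k l'
  · exact hNS k w'
  · exact hNT k w'
  · exact (hNB k' l).symm
  · exact touch_of_mem (Or.inl (start_mem _)) (Or.inl (start_mem _))
  · exact touch_of_mem (Or.inl (start_mem _)) (start_mem _)
  · exact touch_of_mem (Or.inr (end_mem _)) (end_mem _)
  · exact (hNS k' w).symm
  · exact touch_of_mem (start_mem _) (Or.inl (start_mem _))
  · exact touch_of_mem (start_mem _) (start_mem _)
  · exact D.touch_sides w w'
  · exact (hNT k' w).symm
  · exact touch_of_mem (end_mem _) (Or.inr (end_mem _))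
  · exact (D.touch_sides w' w).symm
  · exact touch_of_mem (end_mem _) (end_mem _)

end Staircase

/-! ### Weak depths -/

section ParallelPaths

variable {ι : Type*} {ℓ : ι → ℕ}

theorem edge_meets_startSet {x : ι → ℕ} {i : ι} (hi : x i < ℓ i) {e : ℕ} (he : e < ℓ i) :
    (∃ a ∈ s(pathNode ℓ i e, pathNode ℓ i (e + 1)), a ∈ startSet ℓ x) ↔ e ≤ x i := by
  simp only [Sym2.mem_iff, exists_eq_or_imp, exists_eq_left, mem_startSet hi he.le,
    mem_startSet hi (Nat.succ_le_of_lt he)]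
  omega

theorem edge_meets_endSet {y : ι → ℕ} {i : ι} (hi : y i < ℓ i) {e : ℕ} (he : e < ℓ i) :
    (∃ a ∈ s(pathNode ℓ i e, pathNode ℓ i (e + 1)), a ∈ endSet ℓ y) ↔ ℓ i ≤ e + 1 + y i := by
  simp only [Sym2.mem_iff, exists_eq_or_imp, exists_eq_left, mem_endSet hi he.le,
    mem_endSet hi (Nat.succ_le_of_lt he)]
  omega

theorem edge_meets_innerSet {i i' : ι} {a b e : ℕ} (ha : 1 ≤ a) (hab : a ≤ b) (hb : b < ℓ i') :
    (∃ v ∈ s(pathNode ℓ i e, pathNode ℓ i (e + 1)), v ∈ innerSet ℓ i' a b) ↔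
      i = i' ∧ a ≤ e + 1 ∧ e ≤ b := by
  simp only [Sym2.mem_iff, exists_eq_or_imp, exists_eq_left, mem_innerSet ha hb]
  constructor
  · rintro (⟨rfl, h⟩ | ⟨rfl, h⟩) <;> exact ⟨rfl, by omega⟩
  · rintro ⟨rfl, h⟩
    by_cases h' : a ≤ e
    · exact Or.inl ⟨rfl, by omega⟩
    · exact Or.inr ⟨rfl, by omega⟩

end ParallelPaths

namespace Staircase

variable {α β γ : ℕ} (D : Staircase α β γ)

/-- The number of arcs that meet the `e`-th edge of the path `i`. -/
noncomputable def innerLoad (i : Fin 2 ⊕ Fin γ) (e : ℕ) : ℕ :=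
  {k : Fin D.n | i = Sum.inl 0 ∧ (k : ℕ) ≤ e ∧ e ≤ α - D.n + k}.ncard

/-- The number of sets containing both end nodes that meet the `e`-th edge of the path `i`. -/
noncomputable def bothLoad (i : Fin 2 ⊕ Fin γ) (e : ℕ) : ℕ :=
  {l : Fin (D.n - 1) | e ≤ bothExtents β γ l i ∨
    tripleLengths α β γ i ≤ e + 1 + bothExtents β γ (D.n - 2 - l) i}.ncard

/-- The number of sets containing only the start node that meet the `e`-th edge of the path `i`. -/
noncomputable def startLoad (i : Fin 2 ⊕ Fin γ) (e : ℕ) : ℕ :=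
  {w | e ≤ D.startExtents w i}.ncard

/-- The number of sets containing only the end node that meet the `e`-th edge of the path `i`. -/
noncomputable def endLoad (i : Fin 2 ⊕ Fin γ) (e : ℕ) : ℕ :=
  {w | tripleLengths α β γ i ≤ e + 1 + D.endExtents w i}.ncard

theorem ncard_bramble_eq {i : Fin 2 ⊕ Fin γ} {e : ℕ} (he : e < tripleLengths α β γ i) :
    {u | ∃ a ∈ s(pathNode (tripleLengths α β γ) i e, pathNode _ i (e + 1)), a ∈ D.bramble u}.ncard =
      D.innerLoad i e + D.bothLoad i e + (D.startLoad i e + D.endLoad i e) := by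
  have h1 := D.one_le_n
  have h2 := D.two_mul_n_le
  rw [ncard_sum, ncard_sum, ncard_sum]
  congr 1
  · congr 1
    · unfold innerLoad
      congr 1
      ext k
      refine (edge_meets_innerSet (by omega) (by omega)
        (show α - D.n + k < α by omega)).trans ?_
      simp only [add_le_add_iff_right]
      rfl
    · unfold bothLoad
      congr 1
      ext l
      have h3 := edge_meets_startSet (D.bothExtents_lt (a := l) (by omega) i) he
      have h4 := edge_meets_endSet (D.bothExtents_lt (a := D.n - 2 - l) (by omega) i) he
      refine Iff.trans ?_ (or_congr h3 h4)
      simp only [bramble, Set.mem_ofPred_eq, Set.mem_union, and_or_left, exists_or]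
  · congr 1
    · exact congrArg Set.ncard (Set.ext fun w => edge_meets_startSet (D.startExtents_lt w i) he)
    · exact congrArg Set.ncard (Set.ext fun w => edge_meets_endSet (D.endExtents_lt w i) he)

theorem startLoad_eq (i : Fin 2 ⊕ Fin γ) (e : ℕ) : D.startLoad i e =
    {m | e ≤ D.startExtents (Sum.inl m) i}.ncard +
      ({t | e ≤ D.startExtents (Sum.inr (Sum.inl t)) i}.ncard +
      {u | e ≤ D.startExtents (Sum.inr (Sum.inr u)) i}.ncard) := by
  rw [startLoad, ncard_sum, ncard_sum]

theorem endLoad_eq (i : Fin 2 ⊕ Fin γ) (e : ℕ) : D.endLoad i e =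
    {m | tripleLengths α β γ i ≤ e + 1 + D.endExtents (Sum.inl m) i}.ncard +
      ({t | tripleLengths α β γ i ≤ e + 1 + D.endExtents (Sum.inr (Sum.inl t)) i}.ncard +
      {v | tripleLengths α β γ i ≤ e + 1 + D.endExtents (Sum.inr (Sum.inr v)) i}.ncard) := by
  rw [endLoad, ncard_sum, ncard_sum]

theorem startLoad_le (i : Fin 2 ⊕ Fin γ) (e : ℕ) : D.startLoad i e ≤ γ + 1 + D.U := by
  refine (ncard_le_card _).trans_eq ?_
  simp only [Fintype.card_sum, Fintype.card_fin, Fintype.card_unit]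
  omega

theorem endLoad_le (i : Fin 2 ⊕ Fin γ) (e : ℕ) : D.endLoad i e ≤ γ + 1 + D.U := by
  refine (ncard_le_card _).trans_eq ?_
  simp only [Fintype.card_sum, Fintype.card_fin, Fintype.card_unit]
  omega

theorem bothLoad_le (i : Fin 2 ⊕ Fin γ) (e : ℕ) : D.bothLoad i e ≤ D.n - 1 :=
  (ncard_le_card _).trans_eq (Fintype.card_fin _)

theorem innerLoad_le (i : Fin 2 ⊕ Fin γ) (e : ℕ) : D.innerLoad i e ≤ D.n :=
  (ncard_le_card _).trans_eq (Fintype.card_fin _)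

theorem innerLoad_eq_zero {i : Fin 2 ⊕ Fin γ} (hi : i ≠ Sum.inl 0) (e : ℕ) :
    D.innerLoad i e = 0 :=
  ncard_eq_zero_of_forall_not fun _ h => hi h.1

/-- On the outer edges of the first path the arcs together with the sets containing both end nodes
contribute `n`, and on the inner edges the first counting condition applies. -/
theorem load_first_le {e : ℕ} (he : e < α) :
    D.innerLoad (Sum.inl 0) e + D.bothLoad (Sum.inl 0) e +
      (D.startLoad (Sum.inl 0) e + D.endLoad (Sum.inl 0) e) ≤ D.depth := by
  have h1 := D.one_le_n
  have h2 := D.two_mul_n_le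
  have h3 := D.p_le
  have hS := D.startLoad_le (Sum.inl 0) e
  have hT := D.endLoad_le (Sum.inl 0) e
  have hboth : ∀ l : Fin (D.n - 1), (e ≤ bothExtents β γ l (Sum.inl 0) ∨
      tripleLengths α β γ (Sum.inl 0) ≤ e + 1 + bothExtents β γ (D.n - 2 - l) (Sum.inl 0)) →
      (e ≤ l ∨ α ≤ e + 1 + (D.n - 2 - l)) := fun l h => h
  unfold depth
  rcases lt_or_ge e D.n with h | h
  · -- Near the start node, one arc appears and one set containing both end nodes disappears with
    -- each step.
    have hN : D.innerLoad (Sum.inl 0) e ≤ min D.n (e + 1) := by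
      rw [← ncard_fin_lt]
      exact ncard_le_of_imp fun k hk => Nat.lt_succ_of_le hk.2.1
    have hB : D.bothLoad (Sum.inl 0) e ≤ D.n - 1 - e := by
      rw [← ncard_fin_ge]
      refine ncard_le_of_imp fun l hl => ?_
      have := hboth l hl
      omega
    have hT : D.endLoad (Sum.inl 0) e = 0 := by
      refine ncard_eq_zero_of_forall_not fun w hw => ?_
      rcases w with m | _ | v
      · change α ≤ e + 1 + (D.n - 1) at hw
        omega
      · change α ≤ e + 1 + (D.n - 1) at hw
        omega
      · have := D.j_bounds v
        change α ≤ e + 1 + (α - 1 - D.p - D.j v) at hw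
        omega
    omega
  rcases le_or_gt (α - D.n) e with h' | h'
  · have hN : D.innerLoad (Sum.inl 0) e ≤ D.n - (e - (α - D.n)) := by
      rw [← ncard_fin_ge]
      refine ncard_le_of_imp fun k hk => ?_
      have := hk.2.2
      omega
    have hB : D.bothLoad (Sum.inl 0) e ≤ min (D.n - 1) (e - (α - D.n)) := by
      rw [← ncard_fin_lt]
      refine ncard_le_of_imp fun l hl => ?_
      have := hboth l hl
      omega
    have hS : D.startLoad (Sum.inl 0) e = 0 := by
      refine ncard_eq_zero_of_forall_not fun w hw => ?_
      rcases w with m | _ | u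
      · change e ≤ D.n - 1 at hw
        omega
      · change e ≤ D.n - 1 at hw
        omega
      · have := D.i_bounds u
        change e ≤ D.p + D.i u at hw
        omega
    omega
  · have hN := D.innerLoad_le (Sum.inl 0) e
    have hB : D.bothLoad (Sum.inl 0) e = 0 := by
      refine ncard_eq_zero_of_forall_not fun l hl => ?_
      have := hboth l hl
      omega
    have hS : D.startLoad (Sum.inl 0) e ≤ {u | ¬ D.i u < e - D.p}.ncard := by
      rw [startLoad_eq, ncard_eq_zero_of_forall_not, ncard_eq_zero_of_forall_not, zero_add, zero_add]
      · refine ncard_le_of_imp fun u hu => ?_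
        change e ≤ D.p + D.i u at hu
        omega
      · intro _ hw
        change e ≤ D.n - 1 at hw
        omega
      · intro _ hw
        change e ≤ D.n - 1 at hw
        omega
    have hT : D.endLoad (Sum.inl 0) e ≤ {v | D.j v ≤ e - D.p}.ncard := by
      rw [endLoad_eq, ncard_eq_zero_of_forall_not, ncard_eq_zero_of_forall_not, zero_add, zero_add]
      · refine ncard_le_of_imp fun v hv => ?_
        have := D.j_bounds v
        change α ≤ e + 1 + (α - 1 - D.p - D.j v) at hv
        omega
      · intro _ hw
        change α ≤ e + 1 + (D.n - 1) at hw
        omega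
      · intro _ hw
        change α ≤ e + 1 + (D.n - 1) at hw
        omega
    have h5 := D.count_first (e - D.p)
    have h6 := ncard_add_ncard_not fun u => D.i u < e - D.p
    rw [Fintype.card_fin] at h6
    omega

/-- On the outer edges of the second path the sets containing both end nodes leave room for one
further set, and on the inner edges the second counting condition applies. -/
theorem load_second_le {e : ℕ} (he : e < β) :
    D.innerLoad (Sum.inl 1) e + D.bothLoad (Sum.inl 1) e +
      (D.startLoad (Sum.inl 1) e + D.endLoad (Sum.inl 1) e) ≤ D.depth := by
  have h1 := D.one_le_n
  have hβ1 := D.beta_eq_one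
  have hS := D.startLoad_le (Sum.inl 1) e
  have hT := D.endLoad_le (Sum.inl 1) e
  have hB := D.bothLoad_le (Sum.inl 1) e
  rw [D.innerLoad_eq_zero (by simp)]
  have hSc : {t | e ≤ D.startExtents (Sum.inr (Sum.inl t)) (Sum.inl 1)}.ncard ≤ 1 :=
    ncard_le_card _
  have hTc : {t | tripleLengths α β γ (Sum.inl 1) ≤
      e + 1 + D.endExtents (Sum.inr (Sum.inl t)) (Sum.inl 1)}.ncard ≤ 1 :=
    ncard_le_card _
  -- Only the set that covers the second path comes from the other end to the outer edges.
  have hS1 : 1 ≤ e → D.startLoad (Sum.inl 1) e ≤ 1 + {u | e + D.i u ≤ D.q}.ncard := by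
    intro h
    rw [startLoad_eq, ncard_eq_zero_of_forall_not, zero_add]
    · refine add_le_add hSc (ncard_le_of_imp fun u hu => ?_)
      change e ≤ D.q - D.i u at hu
      omega
    · intro m hm
      change e ≤ 0 at hm
      omega
  have hT1 : e + 1 < β → D.endLoad (Sum.inl 1) e ≤ 1 + {v | D.q < e + D.j v}.ncard := by
    intro h
    rw [endLoad_eq, ncard_eq_zero_of_forall_not, zero_add]
    · refine add_le_add hTc (ncard_le_of_imp fun v hv => ?_)
      have := D.j_bounds v
      change β ≤ e + 1 + (β - 2 - D.q + D.j v) at hv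
      omega
    · intro m hm
      change β ≤ e + 1 + 0 at hm
      omega
  unfold depth
  rcases Nat.eq_zero_or_pos e with rfl | h
  · rcases Nat.lt_or_ge 1 β with h' | h'
    · have := hT1 h'
      rw [ncard_eq_zero_of_forall_not (P := fun v => D.q < 0 + D.j v)
        fun v hv => by have := D.j_bounds v; omega] at this
      omega
    · have := hβ1 (by omega)
      omega
  rcases Nat.lt_or_ge (e + 1) β with h' | h'
  · have hB : D.bothLoad (Sum.inl 1) e = 0 := by
      refine ncard_eq_zero_of_forall_not fun l hl => ?_
      change e ≤ (if β = 2 then 1 else 0) ∨ β ≤ e + 1 + (if β = 2 then 1 else 0) at hl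
      rw [if_neg (by omega)] at hl
      omega
    have h3 := hS1 h
    have h4 := hT1 h'
    rcases le_or_gt e D.q with h5 | h5
    · have h6 := D.count_second (D.q - e)
      have h7 : {u | e + D.i u ≤ D.q}.ncard ≤ {u | D.i u ≤ D.q - e}.ncard :=
        ncard_le_of_imp fun u hu => by omega
      have h8 : {v | D.q < e + D.j v}.ncard ≤ {v | ¬ D.j v ≤ D.q - e}.ncard :=
        ncard_le_of_imp fun u hu => by omega
      have h9 := ncard_add_ncard_not fun v => D.j v ≤ D.q - e
      rw [Fintype.card_fin] at h9
      omega
    · have h6 : {u | e + D.i u ≤ D.q}.ncard = 0 :=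
        ncard_eq_zero_of_forall_not fun u hu => by omega
      have h7 : {v | D.q < e + D.j v}.ncard ≤ D.U :=
        (ncard_le_card _).trans_eq (Fintype.card_fin _)
      omega
  · have := hS1 h
    rw [ncard_eq_zero_of_forall_not (P := fun u => e + D.i u ≤ D.q)
      fun u hu => by have := D.i_bounds u; omega] at this
    omega

/-- Only the set at the other end node that is assigned to this path of length two adds to the load
caused by the sets at one end node and by those that contain both. -/
theorem load_two_le (m : Fin γ) {e : ℕ} (he : e < 2) :
    D.innerLoad (Sum.inr m) e + D.bothLoad (Sum.inr m) e +
      (D.startLoad (Sum.inr m) e + D.endLoad (Sum.inr m) e) ≤ D.depth := by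
  have h1 := D.one_le_n
  have hS := D.startLoad_le (Sum.inr m) e
  have hT := D.endLoad_le (Sum.inr m) e
  have hB := D.bothLoad_le (Sum.inr m) e
  rw [D.innerLoad_eq_zero (by simp)]
  have hm : {m' : Fin γ | m' = m}.ncard = 1 := Set.ncard_singleton m
  unfold depth
  obtain rfl | rfl : e = 0 ∨ e = 1 := by omega
  · have : D.endLoad (Sum.inr m) 0 ≤ 1 := by
      rw [endLoad_eq, ncard_eq_zero_of_forall_not (A := Unit),
        ncard_eq_zero_of_forall_not (A := Fin D.U), add_zero, add_zero]
      · refine (ncard_le_of_imp fun m' h => ?_).trans hm.le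
        change 2 ≤ 0 + 1 + (if m = m' then 1 else 0) at h
        split_ifs at h with h'
        · exact h'.symm
        · omega
      · intro _ h
        change 2 ≤ 0 + 1 + 0 at h
        omega
      · intro _ h
        change 2 ≤ 0 + 1 + 0 at h
        omega
    omega
  · have : D.startLoad (Sum.inr m) 1 ≤ 1 := by
      rw [startLoad_eq, ncard_eq_zero_of_forall_not (A := Unit),
        ncard_eq_zero_of_forall_not (A := Fin D.U), add_zero, add_zero]
      · refine (ncard_le_of_imp fun m' h => ?_).trans hm.le
        change 1 ≤ (if m = m' then 1 else 0) at h
        split_ifs at h with h'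
        · exact h'.symm
        · omega
      · intro _ h
        change 1 ≤ 0 at h
        omega
      · intro _ h
        change 1 ≤ 0 at h
        omega
    omega

theorem two_sub_le_clemb (D : Staircase α β γ) :
    2 - 1 / (D.depth : ℝ) ≤ clemb (pGraphTriple α β γ) := by
  have h1 := D.one_le_n
  have hd : 2 ≤ D.depth := by unfold depth; omega
  have hH : (pGraphTriple α β γ).Connected :=
    (SimpleGraph.induceUnivIso _).connected_iff.1
      (connected_pGraph (Sum.inl 0) (D.one_le_length _))
  have : Nontrivial (PNode (tripleLengths α β γ)) := ⟨Sum.inl false, Sum.inl true, by simp⟩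
  have key := card_div_le_clemb hH D.bramble (by rw [card_index]; omega) D.connected_bramble
    D.touch_bramble D.depth (by
      intro e he
      obtain ⟨i, e, h, rfl⟩ := exists_of_mem_edgeSet_pGraph he
      rw [D.ncard_bramble_eq h]
      rcases i with i | m
      · fin_cases i
        · exact D.load_first_le h
        · exact D.load_second_le h
      · exact D.load_two_le m h)
  refine le_trans (le_of_eq ?_) key
  have h0 : (D.depth : ℝ) ≠ 0 := by positivity
  rw [card_index, Nat.cast_sub (by omega)]
  push_cast
  field_simp

end Staircase

/-! ### Choice of the levels -/

namespace Staircase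

variable {α β γ : ℕ}

/-- Levels that increase by one every `n + 2 * γ` steps, the levels at the end node being shifted by
`n + γ - 1` steps against those at the start node. This is the greedy solution of the two counting
conditions: each of them holds with equality as long as both levels vary. The hypotheses on `M` and
`M'` say that these numbers bound the levels at the start node and at the end node. -/
def ofPeriod (n U p q o M M' : ℕ) (hn : 1 ≤ n) (h2n : 2 * n ≤ α) (hγ : γ = 0 → n = 1 ∨ β = 2)
    (hpn : p ≤ n) (hq : q + 2 ≤ β) (hM : U + o ≤ (M + 1) * (n + 2 * γ))
    (hM' : U + o + n + γ ≤ (M' + 1) * (n + 2 * γ) + 1) (hpM : p + M + n + 1 ≤ α)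
    (hpM' : p + M' + n ≤ α) (hq' : M' ≤ q) (hp : n ≤ p ∨ n ≤ p + 1 ∧ o = γ + 1) :
    Staircase α β γ where
  n := n
  U := U
  p := p
  q := q
  i u := (u + o) / (n + 2 * γ)
  j v := (v + o + (n + γ - 1)) / (n + 2 * γ)
  one_le_n := hn
  two_mul_n_le := h2n
  one_le_beta := by omega
  beta_eq_one h := by omega
  gamma_eq_zero := hγ
  p_le := hpn
  i_bounds u := by
    have hu : (u + o) / (n + 2 * γ) < M + 1 := by
      rw [Nat.div_lt_iff_lt_mul (by omega)]
      omega
    generalize (u + o) / (n + 2 * γ) = r at hu ⊢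
    omega
  j_bounds v := by
    have hv : (v + o + (n + γ - 1)) / (n + 2 * γ) < M' + 1 := by
      rw [Nat.div_lt_iff_lt_mul (by omega)]
      omega
    have hv' : o = γ + 1 → 1 ≤ (v + o + (n + γ - 1)) / (n + 2 * γ) := by
      intro h
      rw [Nat.le_div_iff_mul_le (by omega)]
      omega
    generalize (v + o + (n + γ - 1)) / (n + 2 * γ) = r at hv hv' ⊢
    omega
  count_first f := by
    have hj : {v : Fin U | (v + o + (n + γ - 1)) / (n + 2 * γ) ≤ f}.ncard ≤
        min U ((f + 1) * (n + 2 * γ) - (o + (n + γ - 1))) := by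
      rw [← ncard_fin_lt]
      refine ncard_le_of_imp fun v hv => ?_
      rw [← Nat.lt_succ_iff, Nat.succ_eq_add_one, Nat.div_lt_iff_lt_mul (by omega)] at hv
      omega
    have hi : min U (f * (n + 2 * γ) - o) ≤ {u : Fin U | (u + o) / (n + 2 * γ) < f}.ncard := by
      rw [← ncard_fin_lt]
      refine ncard_le_of_imp fun v hv => ?_
      rw [Nat.div_lt_iff_lt_mul (by omega)]
      omega
    rw [add_mul, one_mul] at hj
    omega
  count_second g := by
    have hi : {u : Fin U | (u + o) / (n + 2 * γ) ≤ g}.ncard ≤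
        min U ((g + 1) * (n + 2 * γ) - o) := by
      rw [← ncard_fin_lt]
      refine ncard_le_of_imp fun v hv => ?_
      rw [← Nat.lt_succ_iff, Nat.succ_eq_add_one, Nat.div_lt_iff_lt_mul (by omega)] at hv
      omega
    have hj : min U ((g + 1) * (n + 2 * γ) - (o + (n + γ - 1))) ≤
        {v : Fin U | (v + o + (n + γ - 1)) / (n + 2 * γ) ≤ g}.ncard := by
      rw [← ncard_fin_lt]
      refine ncard_le_of_imp fun v hv => ?_
      rw [← Nat.lt_succ_iff, Nat.succ_eq_add_one, Nat.div_lt_iff_lt_mul (by omega)]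
      omega
    omega

/-- The staircase that is limited by the second path, for a first path with at least
`2 * n + β - 1` edges. Here `β = b + 2`. -/
theorem two_sub_le_clemb_of_long {n b : ℕ} (hn : 1 ≤ n) (hγ : γ = 0 → n = 1 ∨ b = 0)
    (hα : 2 * n + b + 1 ≤ α) :
    2 - 1 / ((n + 2 * γ + 2 + b * (n + 2 * γ) : ℕ) : ℝ) ≤ clemb (pGraphTriple α (b + 2) γ) := by
  have h := two_sub_le_clemb (ofPeriod (α := α) (β := b + 2) (γ := γ) n
    (γ + 1 + b * (n + 2 * γ)) n b 0 b b hn (by omega) (by omega) le_rfl le_rfl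
    (by rw [add_mul]; omega) (by rw [add_mul]; omega) (by omega) (by omega) le_rfl (by omega))
  convert h using 4
  simp only [depth, ofPeriod]
  ring

/-- The staircase that is limited by the second path, for a first path with at least
`2 * n + β - 2` edges. Here `β = b + 2`. -/
theorem two_sub_le_clemb_of_medium {n b : ℕ} (hn : 1 ≤ n) (hγ : γ = 0 → n = 1 ∨ b = 0)
    (hα : 2 * n + b ≤ α) :
    2 - 1 / ((n + γ + 1 + b * (n + 2 * γ) : ℕ) : ℝ) ≤ clemb (pGraphTriple α (b + 2) γ) := by
  have h := two_sub_le_clemb (ofPeriod (α := α) (β := b + 2) (γ := γ) n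
    (b * (n + 2 * γ)) (n - 1) b (γ + 1) b b hn (by omega) (by omega) (by omega) le_rfl
    (by rw [add_mul]; omega) (by rw [add_mul]; omega) (by omega) (by omega) le_rfl (by omega))
  convert h using 4
  simp only [depth, ofPeriod]

/-- The staircase that is limited by the first path. Here `L` is the number of edges that
join nodes common to all arcs. -/
theorem two_sub_le_clemb_of_short {n L : ℕ} (hn : 1 ≤ n) (hγ : γ = 0 → n = 1 ∨ β = 2)
    (hα : α = 2 * n + L) (hβ : L + 3 ≤ β) :
    2 - 1 / ((2 * (n + γ) + L * (n + 2 * γ) : ℕ) : ℝ) ≤ clemb (pGraphTriple α β γ) := by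
  have h := two_sub_le_clemb (ofPeriod (α := α) (β := β) (γ := γ) n
    (L * (n + 2 * γ) + (n + γ - 1)) (n - 1) (L + 1) (γ + 1) L (L + 1) hn (by omega) hγ (by omega)
    (by omega) (by rw [add_mul]; omega) (by rw [add_mul, add_mul]; omega) (by omega) (by omega)
    le_rfl (by omega))
  convert h using 4
  simp only [depth, ofPeriod]
  omega

/-- The triangle, where the bramble consists of the three singletons. -/
def triangle : Staircase 2 1 0 where
  n := 1
  U := 0
  p := 0
  q := 0
  i _ := 0
  j _ := 0
  one_le_n := le_rfl
  two_mul_n_le := le_rfl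
  one_le_beta := le_rfl
  beta_eq_one _ := ⟨rfl, rfl, rfl⟩
  gamma_eq_zero _ := Or.inl rfl
  p_le := by omega
  i_bounds u := u.elim0
  j_bounds v := v.elim0
  count_first _ := by simp
  count_second _ := by simp

end Staircase

/-! ### The edge, and the comparison with the savings function -/

theorem one_le_clemb_edge : 1 ≤ clemb (pGraphTriple 1 0 0) := by
  have hconn := connected_pGraph (ℓ := tripleLengths 1 0 0) (Sum.inl 0) le_rfl
  have : Nontrivial (PNode (tripleLengths 1 0 0)) := ⟨Sum.inl false, Sum.inl true, by simp⟩
  have h := card_div_le_clemb (I := Fin 3) ((SimpleGraph.induceUnivIso _).connected_iff.1 hconn)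
    (fun _ => Set.univ) (by simp) (fun _ => ⟨Set.univ_nonempty, hconn⟩)
    (fun _ _ => touch_of_mem (v := Sum.inl false) trivial trivial) 3
    (fun _ _ => (ncard_le_card _).trans_eq (Fintype.card_fin 3))
  have h' : 1 ≤ clemb (pGraph (tripleLengths 1 0 0)) := by simpa using h
  exact h'

/-- The bound for all triples except those of the edge and of the triangle. -/
theorem two_sub_savings_le_clemb {α β γ : ℕ} (hαβ : β ≤ α) (hβ : 2 ≤ β) (hγ : γ = 0 → β = 2) :
    2 - 1 / savings α β γ ≤ clemb (pGraphTriple α β γ) := by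
  obtain ⟨b, rfl⟩ : ∃ b, β = b + 2 := ⟨β - 2, by omega⟩
  unfold savings
  simp only [Nat.even_iff, Nat.odd_iff]
  split_ifs with h1 h2 h3 h4 h5 h6 h7 h8
  · obtain ⟨n, rfl⟩ : ∃ n, α = 2 * n + b + 2 := ⟨(α - b - 2) / 2, by omega⟩
    convert Staircase.two_sub_le_clemb_of_long (α := 2 * n + b + 2) (n := n) (b := b) (γ := γ)
      (by omega) (by omega) (by omega) using 2
    push_cast
    ring
  · obtain ⟨n, hn, rfl⟩ : ∃ n, 1 ≤ n ∧ α = 2 * n + b := ⟨(α - b) / 2, by omega, by omega⟩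
    convert Staircase.two_sub_le_clemb_of_medium (α := 2 * n + b) (n := n) (b := b) (γ := γ)
      (by omega) (by omega) (by omega) using 2
    push_cast
    ring
  · obtain ⟨L, rfl⟩ : ∃ L, b = L + 2 := ⟨b - 2, by omega⟩
    obtain ⟨n, hn, rfl⟩ : ∃ n, 1 ≤ n ∧ α = 2 * n + L := ⟨(α - L) / 2, by omega, by omega⟩
    convert Staircase.two_sub_le_clemb_of_short (α := 2 * n + L) (β := L + 2 + 2) (n := n) (L := L)
      (γ := γ) (by omega) (by omega) (by omega) (by omega) using 2
    push_cast
    ring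
  · obtain ⟨n, hn, rfl⟩ : ∃ n, 1 ≤ n ∧ α = 2 * n + b + 1 := ⟨(α - b - 1) / 2, by omega, by omega⟩
    convert Staircase.two_sub_le_clemb_of_long (α := 2 * n + b + 1) (n := n) (b := b) (γ := γ)
      (by omega) (by omega) (by omega) using 2
    push_cast
    ring
  · obtain ⟨L, rfl⟩ : ∃ L, b = L + 1 := ⟨b - 1, by omega⟩
    obtain ⟨n, hn, rfl⟩ : ∃ n, 1 ≤ n ∧ α = 2 * n + L := ⟨(α - L) / 2, by omega, by omega⟩
    convert Staircase.two_sub_le_clemb_of_short (α := 2 * n + L) (β := L + 1 + 2) (n := n) (L := L)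
      (γ := γ) (by omega) (by omega) (by omega) (by omega) using 2
    push_cast
    ring
  -- In the remaining cases the depth is a concave quadratic function of `n`, which is maximal next to
  -- `n = (α + 2) / 4 - γ`.
  · obtain ⟨n, hn⟩ : ∃ n, α = 4 * (n + γ) := ⟨α / 4 - γ, by omega⟩
    convert Staircase.two_sub_le_clemb_of_short (α := α) (β := b + 2) (n := n) (L := 2 * n + 4 * γ)
      (γ := γ) (by omega) (by omega) (by omega) (by omega) using 2
    rw [hn]
    push_cast
    ring
  · obtain ⟨n, hn, h | h⟩ : ∃ n, 1 ≤ n ∧ (α + 3 = 4 * (n + γ) ∨ α + 1 = 4 * (n + γ)) :=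
      ⟨(α + 3) / 4 - γ, by omega, by omega⟩
    all_goals
      obtain ⟨L, hL⟩ : ∃ L, α = 2 * n + L := ⟨α - 2 * n, by omega⟩
      convert Staircase.two_sub_le_clemb_of_short (α := α) (β := b + 2) (n := n) (L := L)
        (γ := γ) (by omega) (by omega) (by omega) (by omega) using 2
      rify at h hL
      push_cast
      rw [show (L : ℝ) = α - 2 * n by linarith]
      first
      | rw [show (α : ℝ) = 4 * (n + γ) - 3 by linarith]
      | rw [show (α : ℝ) = 4 * (n + γ) - 1 by linarith]
      ring
  · obtain ⟨n, hn, h⟩ : ∃ n, 1 ≤ n ∧ α + 2 = 4 * (n + γ) := ⟨(α + 2) / 4 - γ, by omega, by omega⟩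
    obtain ⟨L, hL⟩ : ∃ L, α = 2 * n + L := ⟨α - 2 * n, by omega⟩
    convert Staircase.two_sub_le_clemb_of_short (α := α) (β := b + 2) (n := n) (L := L)
      (γ := γ) (by omega) (by omega) (by omega) (by omega) using 2
    rify at h hL
    push_cast
    rw [show (L : ℝ) = α - 2 * n by linarith, show (α : ℝ) = 4 * (n + γ) - 2 by linarith]
    ring
  · omega

theorem mainTheorem3 (α β γ : ℕ) (h : (α, β, γ) ∈ simpleTriples) :
    clemb (pGraphTriple α β γ) ≥ 2 - 1 / savings α β γ := by
  rcases h with ((⟨a, b, c, h1, h2, h3, h⟩ | ⟨k, hk, h⟩) | h) | h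
  · obtain ⟨rfl, rfl, rfl⟩ : α = a ∧ β = b ∧ γ = c := by simpa using h
    exact two_sub_savings_le_clemb h1 h2 (by omega)
  · obtain ⟨rfl, rfl, rfl⟩ : α = k - 2 ∧ β = 2 ∧ γ = 0 := by simpa using h
    exact two_sub_savings_le_clemb (by omega) le_rfl fun _ => rfl
  · obtain ⟨rfl, rfl, rfl⟩ : α = 1 ∧ β = 0 ∧ γ = 0 := by simpa using h
    have hs : savings 1 0 0 = 1 := by norm_num [savings]
    rw [hs]
    linarith [one_le_clemb_edge]
  · obtain ⟨rfl, rfl, rfl⟩ : α = 2 ∧ β = 1 ∧ γ = 0 := by simpa using h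
    have hs : savings 2 1 0 = 2 := by norm_num [savings, Nat.odd_iff, Nat.even_iff]
    rw [hs]
    simpa [Staircase.depth, Staircase.triangle] using Staircase.triangle.two_sub_le_clemb
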